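/- Let $k$ be a field, $R=k[x_1,\dots,x_n]$ with its standard grading and homogeneous maximal ideal $\mathfrak m=(x_1,\dots,x_n)$. For an ideal $I\subseteq R$ let $I^{(s)}=\bigcap_{\mathfrak p\in\operatorname{Ass}(R/I)}(I^sR_{\mathfrak p}\cap R)$ be its $s$-th symbolic power, $\overline{I}$ its integral closure, $\mathcal R_s(I)=\bigoplus_{s\ge 0}I^{(s)}T^s\subseteq R[T]$ its symbolic Rees algebra, and, for $I\neq 0$, let $\alpha(I)$ be the least degree of a nonzero element of $I$. For a nonzero proper homogeneous ideal $I$ put $$\widehat\alpha(I)=\lim_{s\to\infty}\frac{\alpha(I^{(s)})}{s},\qquad \widehat\rho(I)=\sup\Big\{\frac sr \;:\; s,r\ge 1,\ I^{(su)}\not\subseteq I^{ru}\text{ for all } u\gg 0\Big\}.$$ Let $\mathfrak a_1,\dots,\mathfrak a_m$ be nonzero proper homogeneous ideals of $R$ such that (P1) for all $1\le t\le m$, $\mathcal R_s(\mathfrak a_t)=R[\mathfrak a_tT,\mathfrak a_{t+1}T^2,\dots,\mathfrak a_mT^{m-t+1}]$; (P2) for all $0\le t\le m-1$, $\alpha(\mathfrak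 a_{t+1})=\alpha(\mathfrak a_1)+t$; (P3) with $N=0$: $\mathfrak a_1$ is generated by linear forms and, for all $1\le t\le m$ and $s\ge 1$, $$\overline{\mathfrak a_t^{\,s}}=\mathfrak a_1^{ts}\cap\bigcap_{j=2}^{t}\mathfrak a_j^{(s(t-j+1))}.$$ Then for every $1\le t\le m$ the limit defining $\widehat\alpha(\mathfrak a_t)$ exists, and $$\widehat\rho(\mathfrak a_t)=\frac{\alpha(\mathfrak a_t)}{\widehat\alpha(\mathfrak a_t)}=\frac{t(m-t+1)}{m}.$$ -/

import Mathlib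

open Filter Topology

attribute [local instance] MvPolynomial.gradedAlgebra

noncomputable section

namespace SymbolicPowers

section General

variable {R : Type*} [CommRing R]

/-- The `n`-th symbolic power of `I`: the intersection, over the associated primes `p` of `R ⧸ I`,
of the preimages in `R` of the extended ideals `I ^ n R_p`. -/
def symbolicPower (I : Ideal R) (n : ℕ) : Ideal R :=
  ⨅ p : associatedPrimes R (R ⧸ I),
    ((I ^ n).map (algebraMap R (Localization.AtPrime p.1))).comap
      (algebraMap R (Localization.AtPrime p.1))

theorem symbolicPower_zero (I : Ideal R) : symbolicPower I 0 = ⊤ := by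
  simp [symbolicPower, Ideal.one_eq_top, Ideal.map_top]

theorem mul_mem_symbolicPower (I : Ideal R) {i j : ℕ} {x y : R}
    (hx : x ∈ symbolicPower I i) (hy : y ∈ symbolicPower I j) :
    x * y ∈ symbolicPower I (i + j) := by
  simp only [symbolicPower, Submodule.mem_iInf, Ideal.mem_comap] at hx hy ⊢
  intro p
  rw [map_mul, pow_add, Ideal.map_mul]
  exact Ideal.mul_mem_mul (hx p) (hy p)

/-- The symbolic Rees algebra `⨁ₙ I^(n) Tⁿ`, as a subalgebra of `R[T]`. -/
def symbolicReesAlgebra (I : Ideal R) : Subalgebra R (Polynomial R) where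
  carrier := {f | ∀ i, f.coeff i ∈ symbolicPower I i}
  mul_mem' hf hg i := by
    rw [Polynomial.coeff_mul]
    apply Ideal.sum_mem
    rintro ⟨j, k⟩ e
    rw [← Finset.HasAntidiagonal.mem_antidiagonal.mp e]
    exact mul_mem_symbolicPower I (hf j) (hg k)
  add_mem' hf hg i := by
    rw [Polynomial.coeff_add]
    exact Ideal.add_mem _ (hf i) (hg i)
  algebraMap_mem' r i := by
    rw [Polynomial.algebraMap_apply, Polynomial.coeff_C]
    split_ifs with h
    · subst h
      simp [symbolicPower_zero]
    · exact Ideal.zero_mem _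

/-- The integral closure of the ideal `I`: the elements `x` satisfying an equation
`x ^ n + c₁ x ^ (n - 1) + ⋯ + cₙ = 0` with `n ≥ 1` and `cᵢ ∈ I ^ i`. -/
def idealIntegralClosure (I : Ideal R) : Set R :=
  {x | ∃ n : ℕ, 1 ≤ n ∧ ∃ c : ℕ → R, (∀ i ∈ Finset.Icc 1 n, c i ∈ I ^ i) ∧
    x ^ n + ∑ i ∈ Finset.Icc 1 n, c i * x ^ (n - i) = 0}

/-- The asymptotic resurgence of `I`: the supremum (in the extended reals) of the ratios `s / r`
of positive integers such that `I^(s u)` is not contained in `I ^ (r u)` for all large `u`. -/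
def asymptoticResurgence (I : Ideal R) : EReal :=
  sSup {q : EReal | ∃ s r : ℕ, 1 ≤ s ∧ 1 ≤ r ∧ q = (((s : ℝ) / (r : ℝ) : ℝ) : EReal) ∧
    ∀ᶠ u : ℕ in atTop, ¬ symbolicPower I (s * u) ≤ I ^ (r * u)}

end General

section Polynomial

variable {k : Type*} [Field k] {n : ℕ}

/-- `alpha I` is the least degree of a nonzero element of `I`. -/
def alpha (I : Ideal (MvPolynomial (Fin n) k)) : ℕ :=
  sInf {d | ∃ f ∈ I, f ≠ 0 ∧ f.totalDegree = d}

/-- The Waldschmidt constant: the limit of `alpha (I^(s)) / s` as `s` tends to infinity. -/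
def waldschmidtConstant (I : Ideal (MvPolynomial (Fin n) k)) : ℝ :=
  limUnder atTop (fun s : ℕ => (alpha (symbolicPower I s) : ℝ) / (s : ℝ))

/-- For all `1 ≤ t ≤ m`, the symbolic Rees algebra of `a t` is
`R[(a t) T, (a (t + 1)) T ^ 2, …, (a m) T ^ (m - t + 1)]`. -/
def PropertyP1 (m : ℕ) (a : ℕ → Ideal (MvPolynomial (Fin n) k)) : Prop :=
  ∀ t, 1 ≤ t → t ≤ m → symbolicReesAlgebra (a t) =
    Algebra.adjoin (MvPolynomial (Fin n) k)
      {g | ∃ j, t ≤ j ∧ j ≤ m ∧ ∃ f ∈ a j, g = Polynomial.monomial (j - t + 1) f}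

/-- For all `0 ≤ t ≤ m - 1`, `alpha (a (t + 1)) = alpha (a 1) + t`. -/
def PropertyP2 (m : ℕ) (a : ℕ → Ideal (MvPolynomial (Fin n) k)) : Prop :=
  ∀ t, t + 1 ≤ m → alpha (a (t + 1)) = alpha (a 1) + t

/-- `a 1` is generated by linear forms, and for all `1 ≤ t ≤ m` and `s ≥ 1` the integral closure
of `(𝔪 ^ N (a t)) ^ s` is `(a 1) ^ (N s + t s) ∩ ⋂_{2 ≤ j ≤ t} (a j)^(s (t - j + 1))`, where `𝔪` is
the homogeneous maximal ideal. -/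
def PropertyP3 (N m : ℕ) (a : ℕ → Ideal (MvPolynomial (Fin n) k)) : Prop :=
  (∃ S : Set (MvPolynomial (Fin n) k), (∀ f ∈ S, f.IsHomogeneous 1) ∧ a 1 = Ideal.span S) ∧
  ∀ t, 1 ≤ t → t ≤ m → ∀ s, 1 ≤ s →
    idealIntegralClosure ((MvPolynomial.idealOfVars (Fin n) k ^ N * a t) ^ s) =
      ((a 1 ^ (N * s + t * s) ⊓
        ⨅ j ∈ Finset.Icc 2 t, symbolicPower (a j) (s * (t - j + 1)) :
          Ideal (MvPolynomial (Fin n) k)) : Set (MvPolynomial (Fin n) k))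

end Polynomial

end SymbolicPowers

end

/-! By P2 and P3, `alpha (a t) = t` and `a j` lies in the `j`-th power of the maximal ideal 𝔪. Put e
= m - t + 1. Waldschmidt constant m/e: by P1 the generators of the symbolic Rees algebra are the f
T^(j-t+1) with f in `a j`, and j ≥ (m/e)(j-t+1), so every element of the s-th symbolic power has
order at least (m/e)s. Powers of a degree-m element of `a m`, which lies in the e-th symbolic power
of `a t`, attain this up to a bounded error. Resurgence at least te/m: those powers have degree too
small for (a t)^(ru) ⊆ 𝔪^(tru) once s/r < te/m. Resurgence at most te/m: P3 shows that for f in `a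
j` the power f^(te) is integral over (a t)^(m(j-t+1)) (`pow_mem_idealIntegralClosure`). Hence the
symbolic Rees algebra is contained in a finite module over the Rees algebra of v ↦ (a t)^⌈mv/(te)⌉,
so the v-th symbolic power lies in this filtration up to a bounded shift D
(`exists_symbolicPower_le_pow`). The shift is asymptotically negligible. -/

namespace SymbolicPowers

/-! ### Rees algebras of filtrations and integral dependence -/

section Filtration

variable {R : Type*} [CommRing R]

/-- The Rees algebra `⨁ᵢ F i Tⁱ` of a multiplicative filtration `F`, as a subalgebra of `R[T]`. -/
def filtrationAlgebra (F : ℕ → Ideal R) (h0 : F 0 = ⊤)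
    (hmul : ∀ i j, F i * F j ≤ F (i + j)) : Subalgebra R (Polynomial R) where
  carrier := {f | ∀ i, f.coeff i ∈ F i}
  mul_mem' hf hg i := by
    rw [Polynomial.coeff_mul]
    apply Ideal.sum_mem
    rintro ⟨j, k⟩ e
    rw [← Finset.HasAntidiagonal.mem_antidiagonal.mp e]
    exact hmul j k (Ideal.mul_mem_mul (hf j) (hg k))
  add_mem' hf hg i := by
    rw [Polynomial.coeff_add]
    exact Ideal.add_mem _ (hf i) (hg i)
  algebraMap_mem' r i := by
    rw [Polynomial.algebraMap_apply, Polynomial.coeff_C]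
    split_ifs with h
    · subst h
      simp [h0]
    · exact Ideal.zero_mem _

theorem mem_filtrationAlgebra {F : ℕ → Ideal R} {h0 : F 0 = ⊤}
    {hmul : ∀ i j, F i * F j ≤ F (i + j)} {f : Polynomial R} :
    f ∈ filtrationAlgebra F h0 hmul ↔ ∀ i, f.coeff i ∈ F i := Iff.rfl

theorem monomial_mem_filtrationAlgebra {F : ℕ → Ideal R} {h0 : F 0 = ⊤}
    {hmul : ∀ i j, F i * F j ≤ F (i + j)} {d : ℕ} {x : R} :
    Polynomial.monomial d x ∈ filtrationAlgebra F h0 hmul ↔ x ∈ F d := by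
  rw [mem_filtrationAlgebra]
  refine ⟨fun h => by simpa using h d, fun h i => ?_⟩
  rw [Polynomial.coeff_monomial]
  split_ifs with hi
  · exact hi ▸ h
  · exact Ideal.zero_mem _

theorem mem_symbolicReesAlgebra {I : Ideal R} {f : Polynomial R} :
    f ∈ symbolicReesAlgebra I ↔ ∀ i, f.coeff i ∈ symbolicPower I i := Iff.rfl

theorem monomial_mem_symbolicReesAlgebra {I : Ideal R} {d : ℕ} {x : R} :
    Polynomial.monomial d x ∈ symbolicReesAlgebra I ↔ x ∈ symbolicPower I d := by
  rw [mem_symbolicReesAlgebra]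
  refine ⟨fun h => by simpa using h d, fun h i => ?_⟩
  rw [Polynomial.coeff_monomial]
  split_ifs with hi
  · exact hi ▸ h
  · exact Ideal.zero_mem _

theorem symbolicPower_antitone (I : Ideal R) : Antitone (symbolicPower I) := by
  intro i j hij
  exact iInf_mono fun p => Ideal.comap_mono (Ideal.map_mono (Ideal.pow_le_pow_right hij))

theorem pow_mem_symbolicPower {I : Ideal R} {d : ℕ} {x : R} (hx : x ∈ symbolicPower I d)
    (e : ℕ) : x ^ e ∈ symbolicPower I (d * e) := by
  induction e with
  | zero => simp [symbolicPower_zero]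
  | succ e ih =>
    rw [pow_succ, mul_add, mul_one]
    exact mul_mem_symbolicPower I ih hx

/-- Elements of the span of a finite set over the Rees algebra of a filtration have coefficients
in a shift of the filtration. -/
theorem exists_coeff_mem_of_mem_span {F : ℕ → Ideal R} (h0 : F 0 = ⊤)
    (hmul : ∀ i j, F i * F j ≤ F (i + j)) (hF : Antitone F) (G : Finset (Polynomial R)) :
    ∃ D, ∀ f ∈ Submodule.span (filtrationAlgebra F h0 hmul) (G : Set (Polynomial R)),
      ∀ v, f.coeff v ∈ F (v - D) := by
  refine ⟨G.sup Polynomial.natDegree, fun f hf => ?_⟩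
  set D := G.sup Polynomial.natDegree
  induction hf using Submodule.span_induction with
  | mem g hg =>
    intro v
    rcases le_or_gt v D with hv | hv
    · simp [Nat.sub_eq_zero_of_le hv, h0]
    · rw [Polynomial.coeff_eq_zero_of_natDegree_lt]
      · exact Ideal.zero_mem _
      · exact (Finset.le_sup (f := Polynomial.natDegree) hg).trans_lt hv
  | zero => simp
  | add f g _ _ hf hg =>
    intro v
    rw [Polynomial.coeff_add]
    exact Ideal.add_mem _ (hf v) (hg v)
  | smul c f _ hf =>
    intro v
    rw [Subalgebra.smul_def, smul_eq_mul, Polynomial.coeff_mul]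
    refine Ideal.sum_mem _ ?_
    rintro ⟨i, j⟩ e
    have e' : i + j = v := Finset.HasAntidiagonal.mem_antidiagonal.mp e
    -- Truncated subtraction is harmless: `F 0 = ⊤` covers `j < D`.
    exact hF (by omega : v - D ≤ i + (j - D))
      (hmul _ _ (Ideal.mul_mem_mul (c.2 i) (hf j)))

theorem exists_adjoin_le_span_of_isIntegral {B : Type*} [CommRing B] [Algebra R B]
    (C : Subalgebra R B) (G : Set B) (hfin : G.Finite) (hG : ∀ g ∈ G, IsIntegral C g) :
    ∃ H : Finset B, ∀ f ∈ Algebra.adjoin R G, f ∈ Submodule.span C (H : Set B) := by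
  obtain ⟨H, hH⟩ := fg_adjoin_of_finite hfin hG
  refine ⟨H, fun f hf => ?_⟩
  rw [hH, Subalgebra.mem_toSubmodule]
  induction hf using Algebra.adjoin_induction with
  | mem g hg => exact Algebra.subset_adjoin hg
  | algebraMap r => exact (Algebra.adjoin C G).algebraMap_mem (algebraMap R C r)
  | add f g _ _ hf hg => exact add_mem hf hg
  | mul f g _ _ hf hg => exact mul_mem hf hg

theorem exists_coeff_mem_of_isIntegral {F : ℕ → Ideal R} (h0 : F 0 = ⊤)
    (hmul : ∀ i j, F i * F j ≤ F (i + j)) (hF : Antitone F) (G : Finset (Polynomial R))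
    (hG : ∀ g ∈ G, IsIntegral (filtrationAlgebra F h0 hmul) g) :
    ∃ D, ∀ f ∈ Algebra.adjoin R (G : Set (Polynomial R)), ∀ v, f.coeff v ∈ F (v - D) := by
  obtain ⟨H, hH⟩ := exists_adjoin_le_span_of_isIntegral _ _ G.finite_toSet hG
  obtain ⟨D, hD⟩ := exists_coeff_mem_of_mem_span h0 hmul hF H
  exact ⟨D, fun f hf => hD f (hH f hf)⟩

/-- Multiplying the integral equation of `x` by T^(dN) homogenizes it: the coefficient `c i` becomes
`c i` T^(di), which lies in the Rees algebra of `F`. -/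
theorem isIntegral_monomial {F : ℕ → Ideal R} {h0 : F 0 = ⊤}
    {hmul : ∀ i j, F i * F j ≤ F (i + j)} {I : Ideal R} {d : ℕ} {x : R}
    (hI : ∀ i, I ^ i ≤ F (d * i)) (hx : x ∈ idealIntegralClosure I) :
    IsIntegral (filtrationAlgebra F h0 hmul) (Polynomial.monomial d x) := by
  obtain ⟨N, -, c, hc, h⟩ := hx
  have hb : ∀ i, ∃ b : filtrationAlgebra F h0 hmul,
      i ∈ Finset.Icc 1 N → (b : Polynomial R) = Polynomial.monomial (d * i) (c i) := by
    intro i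
    by_cases hi : i ∈ Finset.Icc 1 N
    · exact ⟨⟨_, monomial_mem_filtrationAlgebra.2 (hI i (hc i hi))⟩, fun _ => rfl⟩
    · exact ⟨0, fun h => absurd h hi⟩
  choose b hb using hb
  refine ⟨Polynomial.X ^ N + ∑ i ∈ Finset.Icc 1 N, Polynomial.C (b i) * Polynomial.X ^ (N - i),
    Polynomial.monic_X_pow_add ?_, ?_⟩
  · rw [← Polynomial.mem_degreeLT]
    refine Submodule.sum_mem _ fun i hi => ?_
    rw [Polynomial.mem_degreeLT]
    refine (Polynomial.degree_C_mul_X_pow_le _ _).trans_lt ?_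
    rw [Finset.mem_Icc] at hi
    exact_mod_cast (by omega : N - i < N)
  · rw [← Polynomial.aeval_def]
    simp only [map_add, map_pow, Polynomial.aeval_X, map_sum, map_mul, Polynomial.aeval_C]
    have : ∀ i ∈ Finset.Icc 1 N, algebraMap (filtrationAlgebra F h0 hmul) (Polynomial R) (b i) *
        Polynomial.monomial d x ^ (N - i) =
        Polynomial.monomial (d * N) (c i * x ^ (N - i)) := by
      intro i hi
      change (b i : Polynomial R) * _ = _
      rw [hb i hi, Polynomial.monomial_pow,
        Polynomial.monomial_mul_monomial, ← mul_add]
      rw [Finset.mem_Icc] at hi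
      rw [show i + (N - i) = N by omega]
    rw [Finset.sum_congr rfl this, ← map_sum, Polynomial.monomial_pow, ← map_add, h, map_zero]

theorem subset_idealIntegralClosure (I : Ideal R) : (I : Set R) ⊆ idealIntegralClosure I := by
  intro x hx
  refine ⟨1, le_rfl, fun _ => -x, fun i hi => ?_, by simp⟩
  obtain rfl : i = 1 := by simpa using hi
  simpa using hx

end Filtration

/-! ### Initial degrees and powers of the maximal ideal -/

section Degree

variable {k : Type*} [Field k] {n : ℕ}

theorem le_totalDegree_of_mem_pow {d : ℕ} {f : MvPolynomial (Fin n) k}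
    (hf : f ∈ MvPolynomial.idealOfVars (Fin n) k ^ d) (h : f ≠ 0) : d ≤ f.totalDegree := by
  rw [MvPolynomial.mem_pow_idealOfVars_iff] at hf
  obtain ⟨x, hx⟩ := MvPolynomial.support_nonempty.2 h
  refine (hf x hx).trans ?_
  simpa [Finsupp.degree_eq_sum, Finsupp.sum_fintype] using MvPolynomial.le_totalDegree hx

theorem alpha_le {I : Ideal (MvPolynomial (Fin n) k)} {f : MvPolynomial (Fin n) k}
    (hf : f ∈ I) (h : f ≠ 0) : alpha I ≤ f.totalDegree :=
  Nat.sInf_le ⟨f, hf, h, rfl⟩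

theorem exists_totalDegree_eq_alpha {I : Ideal (MvPolynomial (Fin n) k)} (hI : I ≠ ⊥) :
    ∃ f ∈ I, f ≠ 0 ∧ f.totalDegree = alpha I := by
  obtain ⟨f, hf, h⟩ := Submodule.exists_mem_ne_zero_of_ne_bot hI
  exact Nat.sInf_mem (s := {d | ∃ f ∈ I, f ≠ 0 ∧ f.totalDegree = d}) ⟨_, f, hf, h, rfl⟩

theorem le_alpha {I : Ideal (MvPolynomial (Fin n) k)} {d : ℕ} (hI : I ≠ ⊥)
    (h : I ≤ MvPolynomial.idealOfVars (Fin n) k ^ d) : d ≤ alpha I := by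
  obtain ⟨f, hf, h0, hd⟩ := exists_totalDegree_eq_alpha hI
  exact hd ▸ le_totalDegree_of_mem_pow (h hf) h0

theorem span_linearForms_le {S : Set (MvPolynomial (Fin n) k)} (hS : ∀ f ∈ S, f.IsHomogeneous 1) :
    Ideal.span S ≤ MvPolynomial.idealOfVars (Fin n) k := by
  rw [Ideal.span_le]
  intro f hf
  rw [SetLike.mem_coe, ← pow_one (MvPolynomial.idealOfVars (Fin n) k),
    MvPolynomial.mem_pow_idealOfVars_iff]
  intro x hx
  have := hS f hf (MvPolynomial.mem_support_iff.1 hx)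
  rw [Finsupp.degree_eq_weight_one]
  exact this.ge

theorem alpha_span_linearForms {S : Set (MvPolynomial (Fin n) k)}
    (hS : ∀ f ∈ S, f.IsHomogeneous 1) (h : Ideal.span S ≠ ⊥) : alpha (Ideal.span S) = 1 := by
  apply le_antisymm
  · obtain ⟨f, hf, h0⟩ : ∃ f ∈ S, f ≠ 0 := by
      by_contra! hcon
      exact h (Ideal.span_eq_bot.2 hcon)
    exact (alpha_le (Ideal.subset_span hf) h0).trans_eq ((hS f hf).totalDegree h0)
  · exact le_alpha h (by simpa using span_linearForms_le hS)

theorem totalDegree_pow_eq {f : MvPolynomial (Fin n) k} (h : f ≠ 0) (e : ℕ) :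
    (f ^ e).totalDegree = e * f.totalDegree := by
  induction e with
  | zero => simp
  | succ e ih =>
    rw [pow_succ, MvPolynomial.totalDegree_mul_of_isDomain (pow_ne_zero _ h) h, ih]
    ring

end Degree

end SymbolicPowers

namespace SymbolicPowers

/-! ### Consequences of P1, P2 and P3 -/

section Families

variable {k : Type*} [Field k] {n m : ℕ} {a : ℕ → Ideal (MvPolynomial (Fin n) k)}

theorem PropertyP1.mem_symbolicPower (hP1 : PropertyP1 m a) {t j : ℕ} (ht : 1 ≤ t) (htj : t ≤ j)
    (hj : j ≤ m) {f : MvPolynomial (Fin n) k} (hf : f ∈ a j) :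
    f ∈ symbolicPower (a t) (j - t + 1) := by
  rw [← monomial_mem_symbolicReesAlgebra, hP1 t ht (htj.trans hj)]
  exact Algebra.subset_adjoin ⟨j, htj, hj, f, hf, rfl⟩

/-- A filtration algebra is a subalgebra, so by P1 it suffices to test the generators of the
symbolic Rees algebra. -/
theorem PropertyP1.symbolicPower_le (hP1 : PropertyP1 m a) {t : ℕ} (ht : 1 ≤ t) (htm : t ≤ m)
    {F : ℕ → Ideal (MvPolynomial (Fin n) k)} (h0 : F 0 = ⊤)
    (hmul : ∀ i j, F i * F j ≤ F (i + j))
    (h : ∀ j, t ≤ j → j ≤ m → a j ≤ F (j - t + 1)) (s : ℕ) : symbolicPower (a t) s ≤ F s := by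
  intro f hf
  rw [← monomial_mem_filtrationAlgebra (h0 := h0) (hmul := hmul)]
  rw [← monomial_mem_symbolicReesAlgebra, hP1 t ht htm] at hf
  refine Algebra.adjoin_le ?_ hf
  rintro _ ⟨j, htj, hj, g, hg, rfl⟩
  exact monomial_mem_filtrationAlgebra.2 (h j htj hj hg)

/-- Noetherianity makes the generators in P1 finite in number, as needed to pass from integral to
module-finite. -/
theorem PropertyP1.exists_finset (hP1 : PropertyP1 m a) {t : ℕ} (ht : 1 ≤ t) (htm : t ≤ m) :
    ∃ G : Finset (Polynomial (MvPolynomial (Fin n) k)),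
      (∀ g ∈ G, ∃ j, t ≤ j ∧ j ≤ m ∧ ∃ f ∈ a j, g = Polynomial.monomial (j - t + 1) f) ∧
      symbolicReesAlgebra (a t) ≤ Algebra.adjoin (MvPolynomial (Fin n) k)
        (G : Set (Polynomial (MvPolynomial (Fin n) k))) := by
  classical
  have hfg : ∀ j, ∃ g : Finset (MvPolynomial (Fin n) k), Ideal.span (g : Set _) = a j :=
    fun j => (isNoetherianRing_iff_ideal_fg _).1 inferInstance (a j)
  choose g hg using hfg
  refine ⟨(Finset.Icc t m).biUnion fun j => (g j).image (Polynomial.monomial (j - t + 1)), ?_, ?_⟩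
  · intro x hx
    simp only [Finset.mem_biUnion, Finset.mem_Icc, Finset.mem_image] at hx
    obtain ⟨j, ⟨h1, h2⟩, f, hf, rfl⟩ := hx
    exact ⟨j, h1, h2, f, hg j ▸ Ideal.subset_span hf, rfl⟩
  · rw [hP1 t ht htm]
    refine Algebra.adjoin_le ?_
    rintro _ ⟨j, htj, hj, f, hf, rfl⟩
    rw [SetLike.mem_coe]
    rw [← hg j] at hf
    induction hf using Submodule.span_induction with
    | mem f hf =>
      refine Algebra.subset_adjoin ?_
      simp only [Finset.coe_biUnion, Set.mem_iUnion, Finset.mem_coe, Finset.mem_image]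
      exact ⟨j, Finset.mem_Icc.2 ⟨htj, hj⟩, f, hf, rfl⟩
    | zero => simp
    | add x y _ _ hx hy => rw [map_add]; exact add_mem hx hy
    | smul c x _ hx =>
      rw [map_smul]
      exact Subalgebra.smul_mem _ hx c

theorem PropertyP3.mem_idealIntegralClosure_iff (hP3 : PropertyP3 0 m a) {t : ℕ} (ht : 1 ≤ t)
    (htm : t ≤ m) {s : ℕ} (hs : 1 ≤ s) {f : MvPolynomial (Fin n) k} :
    f ∈ idealIntegralClosure (a t ^ s) ↔
      f ∈ a 1 ^ (t * s) ∧ ∀ j, 2 ≤ j → j ≤ t → f ∈ symbolicPower (a j) (s * (t - j + 1)) := by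
  have := hP3.2 t ht htm s hs
  rw [pow_zero, one_mul, zero_mul, zero_add] at this
  rw [this, SetLike.mem_coe, Submodule.mem_inf]
  simp only [Submodule.mem_iInf, Finset.mem_Icc, and_imp]

theorem PropertyP3.le_pow (hP3 : PropertyP3 0 m a) {j : ℕ} (h : 1 ≤ j) (hj : j ≤ m) :
    a j ≤ a 1 ^ j := by
  intro f hf
  have := ((hP3.mem_idealIntegralClosure_iff h hj le_rfl).1
    (subset_idealIntegralClosure _ (by simpa using hf))).1
  simpa using this

theorem PropertyP3.le_idealOfVars_pow (hP3 : PropertyP3 0 m a) {j : ℕ} (h : 1 ≤ j) (hj : j ≤ m) :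
    a j ≤ MvPolynomial.idealOfVars (Fin n) k ^ j := by
  obtain ⟨S, hS, hS'⟩ := hP3.1
  exact (hP3.le_pow h hj).trans (Ideal.pow_right_mono (hS' ▸ span_linearForms_le hS) j)

theorem alpha_eq (hne : ∀ t, 1 ≤ t → t ≤ m → a t ≠ ⊥) (hP2 : PropertyP2 m a)
    (hP3 : PropertyP3 0 m a) {t : ℕ} (ht : 1 ≤ t) (htm : t ≤ m) : alpha (a t) = t := by
  obtain ⟨S, hS, hS'⟩ := hP3.1
  have h1 : alpha (a 1) = 1 := by
    have := hne 1 le_rfl (ht.trans htm)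
    rw [hS'] at this ⊢
    exact alpha_span_linearForms hS this
  obtain ⟨t, rfl⟩ := Nat.exists_eq_add_of_le' ht
  rw [hP2 t htm, h1, add_comm]

/-! ### Symbolic powers inside ordinary powers -/

/-- P3 reduces the claim to orders along `a 1` and each `a i` with 2 ≤ i ≤ t; these are known since
f lies in (a 1)^j and, by P1, in the (j-i+1)-th symbolic power of `a i`. -/
theorem pow_mem_idealIntegralClosure (hP1 : PropertyP1 m a) (hP3 : PropertyP3 0 m a) {t j : ℕ}
    (ht : 1 ≤ t) (htj : t ≤ j) (hj : j ≤ m) {f : MvPolynomial (Fin n) k} (hf : f ∈ a j) :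
    f ^ (t * (m - t + 1)) ∈ idealIntegralClosure (a t ^ (m * (j - t + 1))) := by
  have hm : 1 ≤ m := ht.trans (htj.trans hj)
  rw [hP3.mem_idealIntegralClosure_iff ht (htj.trans hj) (Nat.mul_pos hm (Nat.add_one_pos (j - t)))]
  constructor
  · have h := Ideal.pow_mem_pow (hP3.le_pow (ht.trans htj) hj hf) (t * (m - t + 1))
    rw [← pow_mul] at h
    refine Ideal.pow_le_pow_right ?_ h
    obtain ⟨t, rfl⟩ := Nat.exists_eq_add_of_le' ht
    obtain ⟨p, rfl⟩ := Nat.exists_eq_add_of_le htj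
    obtain ⟨q, rfl⟩ := Nat.exists_eq_add_of_le hj
    rw [show t + 1 + p + q - (t + 1) = p + q by omega, show t + 1 + p - (t + 1) = p by omega]
    -- In the original indices the slack is t(t-1)(m-j).
    exact Nat.le.intro (k := (t + 1) * (t * q)) (by ring)
  · intro i hi hit
    refine symbolicPower_antitone _ ?_
      (pow_mem_symbolicPower (hP1.mem_symbolicPower (by omega) (hit.trans htj) hj hf) _)
    obtain ⟨i, rfl⟩ := Nat.exists_eq_add_of_le' (show 1 ≤ i by omega)
    obtain ⟨r, rfl⟩ := Nat.exists_eq_add_of_le hit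
    obtain ⟨p, rfl⟩ := Nat.exists_eq_add_of_le htj
    obtain ⟨q, rfl⟩ := Nat.exists_eq_add_of_le hj
    rw [show i + 1 + r + p + q - (i + 1 + r) = p + q by omega,
      show i + 1 + r + p - (i + 1 + r) = p by omega, show i + 1 + r - (i + 1) = r by omega,
      show i + 1 + r + p - (i + 1) = r + p by omega]
    -- In the original indices the slack is (j-t+1)(i-1)(m-t) + t(t-i)(m-j).
    exact Nat.le.intro (k := (p + 1) * (i * (p + q)) + (i + 1 + r) * (r * q)) (by ring)

theorem exists_symbolicPower_le_pow (hP1 : PropertyP1 m a) (hP3 : PropertyP3 0 m a) {t : ℕ}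
    (ht : 1 ≤ t) (htm : t ≤ m) :
    ∃ D : ℕ, ∀ v : ℕ, symbolicPower (a t) v ≤
      a t ^ ⌈(m : ℝ) / ((t * (m - t + 1) : ℕ) : ℝ) * ((v - D : ℕ) : ℝ)⌉₊ := by
  set w : ℕ := t * (m - t + 1) with hw
  have hw0 : 0 < w := Nat.mul_pos ht (Nat.succ_pos _)
  have hw0' : (w : ℝ) ≠ 0 := by exact_mod_cast hw0.ne'
  set lam : ℝ := (m : ℝ) / (w : ℝ) with hlam
  have hlam0 : 0 ≤ lam := by positivity
  set F : ℕ → Ideal (MvPolynomial (Fin n) k) := fun v => a t ^ ⌈lam * (v : ℝ)⌉₊ with hF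
  have h0 : F 0 = ⊤ := by simp [hF]
  have hmul : ∀ i j, F i * F j ≤ F (i + j) := by
    intro i j
    simp only [hF]
    rw [← pow_add]
    refine Ideal.pow_le_pow_right ?_
    rw [Nat.cast_add i j, mul_add]
    exact Nat.ceil_add_le _ _
  have hanti : Antitone F := by
    intro i j hij
    refine Ideal.pow_le_pow_right (Nat.ceil_mono ?_)
    gcongr
  obtain ⟨G, hG, hGle⟩ := hP1.exists_finset ht htm
  obtain ⟨D, hD⟩ := exists_coeff_mem_of_isIntegral h0 hmul hanti G (by
    intro g hg
    obtain ⟨j, htj, hj, f, hf, rfl⟩ := hG g hg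
    refine IsIntegral.of_pow hw0 ?_
    rw [Polynomial.monomial_pow]
    refine isIntegral_monomial (fun i => ?_) (pow_mem_idealIntegralClosure hP1 hP3 ht htj hj hf)
    rw [← pow_mul]
    -- After raising to the power `w` the exponents are integers, since `lam * w = m`, so rounding
    -- loses nothing.
    refine Ideal.pow_le_pow_right (Nat.ceil_le.2 (le_of_eq ?_))
    rw [hlam]
    push_cast
    field_simp)
  refine ⟨D, fun v f hf => ?_⟩
  have := hD _ (hGle (monomial_mem_symbolicReesAlgebra.2 hf)) v
  simpa using this

/-! ### The Waldschmidt constant -/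

/-- A power of an element of `a m` of least degree gives elements of the symbolic powers of `a t`
of small degree. -/
theorem exists_mem_symbolicPower_totalDegree_le (hne : ∀ t, 1 ≤ t → t ≤ m → a t ≠ ⊥)
    (hP1 : PropertyP1 m a) (hP2 : PropertyP2 m a) (hP3 : PropertyP3 0 m a) {t : ℕ}
    (ht : 1 ≤ t) (htm : t ≤ m) (s : ℕ) :
    ∃ f ∈ symbolicPower (a t) s, f ≠ 0 ∧
      (f.totalDegree : ℝ) ≤ m / ((m - t + 1 : ℕ) : ℝ) * s + m := by
  obtain ⟨g, hg, hg0, hgd⟩ := exists_totalDegree_eq_alpha (hne m (ht.trans htm) le_rfl)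
  rw [alpha_eq hne hP2 hP3 (ht.trans htm) le_rfl] at hgd
  have hc : (0 : ℝ) < ((m - t + 1 : ℕ) : ℝ) := by exact_mod_cast Nat.succ_pos _
  set e := m - t + 1
  refine ⟨g ^ ⌈(s : ℝ) / e⌉₊, ?_, pow_ne_zero _ hg0, ?_⟩
  · refine symbolicPower_antitone _ ?_
      (pow_mem_symbolicPower (hP1.mem_symbolicPower ht htm le_rfl hg) _)
    have := Nat.le_ceil ((s : ℝ) / e)
    rw [div_le_iff₀ hc, mul_comm] at this
    exact_mod_cast this
  · rw [totalDegree_pow_eq hg0, hgd, Nat.cast_mul]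
    calc (⌈(s : ℝ) / e⌉₊ : ℝ) * m ≤ ((s : ℝ) / e + 1) * m := by
          gcongr
          exact (Nat.ceil_lt_add_one (by positivity)).le
      _ = _ := by ring

theorem tendsto_alpha_symbolicPower (hne : ∀ t, 1 ≤ t → t ≤ m → a t ≠ ⊥)
    (hP1 : PropertyP1 m a) (hP2 : PropertyP2 m a) (hP3 : PropertyP3 0 m a) {t : ℕ}
    (ht : 1 ≤ t) (htm : t ≤ m) :
    Tendsto (fun s : ℕ => (alpha (symbolicPower (a t) s) : ℝ) / s) atTop
      (𝓝 (m / ((m - t + 1 : ℕ) : ℝ))) := by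
  have hc : (0 : ℝ) < ((m - t + 1 : ℕ) : ℝ) := by exact_mod_cast Nat.succ_pos _
  have hm : (0 : ℝ) < m := by exact_mod_cast ht.trans htm
  have hlower (s : ℕ) : symbolicPower (a t) s ≤
      MvPolynomial.idealOfVars (Fin n) k ^ ⌈(m : ℝ) / ((m - t + 1 : ℕ) : ℝ) * s⌉₊ := by
    refine hP1.symbolicPower_le ht htm
      (F := fun s => MvPolynomial.idealOfVars (Fin n) k ^ ⌈(m : ℝ) / ((m - t + 1 : ℕ) : ℝ) * s⌉₊)
      (by simp) ?_ ?_ s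
    · intro i j
      rw [← pow_add]
      refine Ideal.pow_le_pow_right ?_
      rw [Nat.cast_add i j, mul_add]
      exact Nat.ceil_add_le _ _
    · intro j htj hj
      refine (hP3.le_idealOfVars_pow (ht.trans htj) hj).trans (Ideal.pow_le_pow_right ?_)
      rw [Nat.ceil_le, div_mul_eq_mul_div, div_le_iff₀ hc]
      norm_cast
      obtain ⟨t, rfl⟩ := Nat.exists_eq_add_of_le' ht
      obtain ⟨p, rfl⟩ := Nat.exists_eq_add_of_le htj
      obtain ⟨q, rfl⟩ := Nat.exists_eq_add_of_le hj
      rw [show t + 1 + p + q - (t + 1) = p + q by omega, show t + 1 + p - (t + 1) = p by omega]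
      -- In the original indices j(m-t+1) - m(j-t+1) = (t-1)(m-j).
      exact Nat.le.intro (k := t * q) (by ring)
  refine tendsto_of_tendsto_of_tendsto_of_le_of_le' tendsto_const_nhds
    (h := fun s : ℕ => (m : ℝ) / ((m - t + 1 : ℕ) : ℝ) + m / (s : ℝ)) ?_ ?_ ?_
  · simpa using (tendsto_const_div_atTop_nhds_zero_nat (m : ℝ)).const_add
      ((m : ℝ) / ((m - t + 1 : ℕ) : ℝ))
  · filter_upwards [eventually_gt_atTop 0] with s hs
    have hs' : (0 : ℝ) < s := by exact_mod_cast hs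
    obtain ⟨f, hf, hf0, -⟩ := exists_mem_symbolicPower_totalDegree_le hne hP1 hP2 hP3 ht htm s
    rw [le_div_iff₀ hs']
    exact Nat.ceil_le.1 (le_alpha (Submodule.ne_bot_iff _ |>.2 ⟨f, hf, hf0⟩) (hlower s))
  · filter_upwards [eventually_gt_atTop 0] with s hs
    have hs' : (0 : ℝ) < s := by exact_mod_cast hs
    obtain ⟨f, hf, hf0, hfd⟩ := exists_mem_symbolicPower_totalDegree_le hne hP1 hP2 hP3 ht htm s
    rw [div_le_iff₀ hs', add_mul, div_mul_cancel₀ _ hs'.ne']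
    exact le_trans (by exact_mod_cast alpha_le hf hf0) hfd

/-! ### The asymptotic resurgence -/

theorem eventually_not_symbolicPower_le (hne : ∀ t, 1 ≤ t → t ≤ m → a t ≠ ⊥)
    (hP1 : PropertyP1 m a) (hP2 : PropertyP2 m a) (hP3 : PropertyP3 0 m a) {t : ℕ}
    (ht : 1 ≤ t) (htm : t ≤ m) {s r : ℕ} (h : m * s < r * (t * (m - t + 1))) :
    ∀ᶠ u : ℕ in atTop, ¬ symbolicPower (a t) (s * u) ≤ a t ^ (r * u) := by
  have hc : (0 : ℝ) < ((m - t + 1 : ℕ) : ℝ) := by exact_mod_cast Nat.succ_pos _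
  have hgap : 0 < (t * r : ℝ) - m / ((m - t + 1 : ℕ) : ℝ) * s := by
    rw [sub_pos, div_mul_eq_mul_div, div_lt_iff₀ hc]
    have : m * s < t * r * (m - t + 1) := by convert h using 1; ring
    exact_mod_cast this
  -- The degree gap grows linearly in `u` and overtakes the rounding error `m`.
  filter_upwards [(tendsto_natCast_atTop_atTop.const_mul_atTop hgap).eventually_gt_atTop (m : ℝ)]
    with u hu hle
  obtain ⟨f, hf, hf0, hfd⟩ :=
    exists_mem_symbolicPower_totalDegree_le hne hP1 hP2 hP3 ht htm (s * u)
  have h1 : f ∈ MvPolynomial.idealOfVars (Fin n) k ^ (t * (r * u)) := by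
    rw [pow_mul]
    exact Ideal.pow_right_mono (hP3.le_idealOfVars_pow ht htm) _ (hle hf)
  have h2 : ((t * (r * u) : ℕ) : ℝ) ≤ f.totalDegree := by
    exact_mod_cast le_totalDegree_of_mem_pow h1 hf0
  push_cast at h2 hfd hu
  linarith [h2.trans hfd]

theorem eventually_symbolicPower_le (hP1 : PropertyP1 m a) (hP3 : PropertyP3 0 m a) {t : ℕ}
    (ht : 1 ≤ t) (htm : t ≤ m) {s r : ℕ} (h : r * (t * (m - t + 1)) < m * s) :
    ∀ᶠ u : ℕ in atTop, symbolicPower (a t) (s * u) ≤ a t ^ (r * u) := by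
  obtain ⟨D, hD⟩ := exists_symbolicPower_le_pow hP1 hP3 ht htm
  have hw : (0 : ℝ) < ((t * (m - t + 1) : ℕ) : ℝ) := by
    exact_mod_cast Nat.mul_pos ht (Nat.succ_pos _)
  set w := t * (m - t + 1)
  have hgap : 0 < (m : ℝ) / w * s - r := by
    rw [sub_pos, div_mul_eq_mul_div, lt_div_iff₀ hw]
    exact_mod_cast h
  -- The linear gain absorbs the loss (m/w)D caused by the shift.
  filter_upwards [(tendsto_natCast_atTop_atTop.const_mul_atTop hgap).eventually_ge_atTop
    ((m : ℝ) / w * D)] with u hu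
  refine (hD (s * u)).trans (Ideal.pow_le_pow_right ?_)
  have h1 : ((s * u : ℕ) : ℝ) - D ≤ ((s * u - D : ℕ) : ℝ) := by
    rw [sub_le_iff_le_add]
    exact_mod_cast (by omega : s * u ≤ s * u - D + D)
  have h2 := mul_le_mul_of_nonneg_left h1 (by positivity : 0 ≤ (m : ℝ) / w)
  have h3 : ((r * u : ℕ) : ℝ) ≤ (m : ℝ) / w * ((s * u - D : ℕ) : ℝ) := by
    refine le_trans ?_ h2
    push_cast
    linarith
  exact_mod_cast h3.trans (Nat.le_ceil _)

theorem asymptoticResurgence_eq (hne : ∀ t, 1 ≤ t → t ≤ m → a t ≠ ⊥)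
    (hP1 : PropertyP1 m a) (hP2 : PropertyP2 m a) (hP3 : PropertyP3 0 m a) {t : ℕ}
    (ht : 1 ≤ t) (htm : t ≤ m) :
    asymptoticResurgence (a t) = ((((t * (m - t + 1) : ℕ) : ℝ) / m : ℝ) : EReal) := by
  have hm : (0 : ℝ) < m := by exact_mod_cast ht.trans htm
  have hw : (0 : ℝ) < ((t * (m - t + 1) : ℕ) : ℝ) := by
    exact_mod_cast Nat.mul_pos ht (Nat.succ_pos _)
  apply le_antisymm
  · refine sSup_le ?_
    rintro _ ⟨s, r, hs, hr, rfl, hu⟩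
    rw [EReal.coe_le_coe_iff]
    have hr' : (0 : ℝ) < r := by exact_mod_cast hr
    by_contra! hcon
    rw [div_lt_div_iff₀ hm hr'] at hcon
    have hlt : r * (t * (m - t + 1)) < m * s := by
      rw [mul_comm r, mul_comm m]
      exact_mod_cast hcon
    obtain ⟨u, h1, h2⟩ := (hu.and (eventually_symbolicPower_le hP1 hP3 ht htm hlt)).exists
    exact h1 h2
  · refine le_of_forall_lt fun c hc => ?_
    have hpos : ((0 : ℝ) : EReal) < ((((t * (m - t + 1) : ℕ) : ℝ) / m : ℝ) : EReal) := by
      rw [EReal.coe_lt_coe_iff]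
      positivity
    -- Taking the maximum with 0 forces `q` to be positive, hence a ratio s/r with s, r ≥ 1.
    obtain ⟨q, hq1, hq2⟩ := EReal.lt_iff_exists_rat_btwn.1 (max_lt hc hpos)
    rw [max_lt_iff] at hq1
    refine hq1.1.trans_le (le_sSup ?_)
    have hq0 : 0 < q := by exact_mod_cast EReal.coe_lt_coe_iff.1 hq1.2
    have hnum : (q.num.toNat : ℤ) = q.num := Int.toNat_of_nonneg (Rat.num_pos.2 hq0).le
    have hqeq : (q : ℝ) = (q.num.toNat : ℝ) / (q.den : ℝ) := by
      conv_lhs => rw [← Rat.num_div_den q, ← hnum]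
      push_cast
      rfl
    have hden : (0 : ℝ) < q.den := by exact_mod_cast q.den_pos
    refine ⟨q.num.toNat, q.den, ?_, q.den_pos, ?_, ?_⟩
    · have := Rat.num_pos.2 hq0
      omega
    · rw [← hqeq]
    · refine eventually_not_symbolicPower_le hne hP1 hP2 hP3 ht htm ?_
      have := EReal.coe_lt_coe_iff.1 hq2
      rw [hqeq, div_lt_div_iff₀ hden hm] at this
      rw [mul_comm m, mul_comm q.den]
      exact_mod_cast this

end Families

end SymbolicPowers

theorem mainTheorem5 {k : Type*} [Field k] (n m : ℕ)
    (a : ℕ → Ideal (MvPolynomial (Fin n) k))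
    (hne : ∀ t, 1 ≤ t → t ≤ m → a t ≠ ⊥)
    (hproper : ∀ t, 1 ≤ t → t ≤ m → a t ≠ ⊤)
    (hhom : ∀ t, 1 ≤ t → t ≤ m →
      (a t).IsHomogeneous (MvPolynomial.homogeneousSubmodule (Fin n) k))
    (hP1 : SymbolicPowers.PropertyP1 m a)
    (hP2 : SymbolicPowers.PropertyP2 m a)
    (hP3 : SymbolicPowers.PropertyP3 0 m a) :
    ∀ t : ℕ, 1 ≤ t → t ≤ m →
      Tendsto (fun s : ℕ => (SymbolicPowers.alpha (SymbolicPowers.symbolicPower (a t) s) : ℝ) / s)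
        atTop (𝓝 (SymbolicPowers.waldschmidtConstant (a t))) ∧
      SymbolicPowers.asymptoticResurgence (a t) =
        (((SymbolicPowers.alpha (a t) : ℝ) / SymbolicPowers.waldschmidtConstant (a t) : ℝ) :
          EReal) ∧
      (SymbolicPowers.alpha (a t) : ℝ) / SymbolicPowers.waldschmidtConstant (a t) =
        (t : ℝ) * ((m : ℝ) - t + 1) / m := by
  intro t ht htm
  have hlim := SymbolicPowers.tendsto_alpha_symbolicPower hne hP1 hP2 hP3 ht htm
  have hw : SymbolicPowers.waldschmidtConstant (a t) = m / ((m - t + 1 : ℕ) : ℝ) :=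
    hlim.limUnder_eq
  have hratio : (SymbolicPowers.alpha (a t) : ℝ) / SymbolicPowers.waldschmidtConstant (a t) =
      ((t * (m - t + 1) : ℕ) : ℝ) / m := by
    rw [hw, SymbolicPowers.alpha_eq hne hP2 hP3 ht htm, div_div_eq_mul_div, Nat.cast_mul]
  refine ⟨hw ▸ hlim, ?_, ?_⟩
  · rw [hratio]
    exact SymbolicPowers.asymptoticResurgence_eq hne hP1 hP2 hP3 ht htm
  · rw [hratio]
    push_cast [Nat.cast_sub htm]
    rfl
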